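/- **Setting.** Let $X$ be a nonempty compact Hausdorff space and let $\mathcal L_{\sf H}$ be an arbitrary first-order language. Consider two sorts, the home sort ${\sf H}$ and the space sort ${\sf S}$, and the two-sorted language $\mathcal L$ consisting of $\mathcal L_{\sf H}$, of a function symbol of sort ${\sf S}^n\to{\sf S}$ for every continuous $f\colon X^n\to X$ ($n\ge 0$), of a predicate symbol for every closed $C\subseteq X^n$ ($n\ge 1$), and of an arbitrary family of function symbols of sorts ${\sf H}^n\to{\sf S}$ ($n\ge 1$). A *standard structure* is an $\mathcal L$-structure $\langle N,X\rangle$ in which $N$ is an $\mathcal L_{\sf H}$-structure and the symbols attached to $X$ have their natural interpretation; it is denoted by $N$. The class $\mathcal F$ is the least class of $\mathcal L$-formulas that contains all $\mathcal L_{\sf H}$-formulas and all formulas $t\in C$, where $C\subseteq X^n$ is closed, $n\ge1$, and $t$ is an $n$-tuple of terms of sort ${\sf S}$, and that is closed under $\wedge$, $\vee$ and under $\forall,\exists$ over both sorts. $\mathcal H\subseteq\mathcal F$ is the class of those formulas with no quantifier of sort ${\sf S}$. $\mathcal F(A)$ and $\mathcal H(A)$ allow names for the elements of $A$ as parameters.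 An *approximation* $\varphi'>\varphi$ of $\varphi\in\mathcal F(A)$ is a formula obtained by replacing each atomic formula $t\in C$ occurring in $\varphi$ by $t\in C'$ for some closed neighbourhood $C'$ of $C$ (the $\mathcal L_{\sf H}$-formulas are left unchanged). A standard structure $N$ is *$\mathcal F$-saturated* if every set $p(x;\eta)\subseteq\mathcal F(A)$, with $A\subseteq N$, $|A|<|N|$ and $x,\eta$ finite tuples of variables of sorts ${\sf H},{\sf S}$, that is finitely realized in $N$ is realized in $N$. A substructure $M$ of $N$ (with the restricted interpretations) is an *$\mathcal F$-elementary substructure* if $M\models\varphi(a)$ implies $N\models\varphi(a)$ for all $\varphi(x)\in\mathcal F$ with no free variables of sort ${\sf S}$ and all tuples $a$ from $M$. **Statement.** Let $\mathcal U$ be an infinite $\mathcal F$-saturated standard structure, and let $M\subseteq\mathcal U$ be a subset. The following are equivalent, where $x$ ranges over finite tuples of variables of sort ${\sf H}$ and truth is evaluated in $\mathcal U$: 1. $M$ is the domain of an $\mathcal F$-elementary substructure of $\mathcal U$; 2. for every $\varphi(x)\in\mathcal H(M)$ without free variables of sort ${\sf S}$: if $\exists x\,\varphi(x)$ holds, then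 for every $\varphi'>\varphi$ there is a tuple $a\in M^{|x|}$ such that $\varphi'(a)$ holds; 3. for every $\varphi(x)\in\mathcal F(M)$ without free variables of sort ${\sf S}$: if $\exists x\,\neg\varphi(x)$ holds, then there is a tuple $a\in M^{|x|}$ such that $\neg\varphi(a)$ holds. Moreover, these are also equivalent to (2) restricted to a single variable $x$, and to (3) restricted to a single variable $x$. -/

import Mathlib

open scoped Topology

universe u v w x y z

namespace TwoSorted

/-- Terms of sort `S` with home-sort variables in `α` and space-sort variables in `β`.
Here `L` is the language of the home sort `H`, and `K n` is the set of function symbols of sort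
`H^(n+1) → S` (so that their arity is at least one).  A symbol of sort `S^n → S`, with `n ≥ 0`, is a
continuous map `X^n → X`; for `n = 0` these are the names of the points of `X`. -/
inductive STerm (L : FirstOrder.Language.{u, v}) (K : ℕ → Type w) (X : Type x) [TopologicalSpace X]
    (α : Type y) (β : Type z) : Type (max u w x y z)
  | var : β → STerm L K X α β
  | space {n : ℕ} (f : C(Fin n → X, X)) (ts : Fin n → STerm L K X α β) : STerm L K X α β
  | mixed {n : ℕ} (f : K n) (ts : Fin (n + 1) → L.Term α) : STerm L K X α β

/-- `FFormula L K X A m k` is the set of formulas `φ(x ; η)` of the class `F(A)`, where `x` is a tuple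
of `m` variables of sort `H`, `η` is a tuple of `k` variables of sort `S`, and each element of `A` is
a name (a free variable of sort `H` that cannot be quantified, to be interpreted by the element it
names).  Parameter-free formulas are those with `A = Empty`.  As in Mathlib's `BoundedFormula`, a
quantifier binds the last variable of the tuple. -/
inductive FFormula (L : FirstOrder.Language.{u, v}) (K : ℕ → Type w) (X : Type x) [TopologicalSpace X]
    (A : Type y) : ℕ → ℕ → Type (max u v w x y)
  /-- an arbitrary first-order formula of the language of the home sort -/
  | home {m k : ℕ} (φ : L.BoundedFormula A m) : FFormula L K X A m k
  /-- `t ∈ C`, for `t` a tuple of `n + 1` terms of sort `S`, and `C ⊆ X^(n+1)` closed -/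
  | mem {m k n : ℕ} (t : Fin (n + 1) → STerm L K X (A ⊕ Fin m) (Fin k))
      (C : TopologicalSpace.Closeds (Fin (n + 1) → X)) : FFormula L K X A m k
  | and {m k : ℕ} (φ ψ : FFormula L K X A m k) : FFormula L K X A m k
  | or {m k : ℕ} (φ ψ : FFormula L K X A m k) : FFormula L K X A m k
  | allH {m k : ℕ} (φ : FFormula L K X A (m + 1) k) : FFormula L K X A m k
  | exH {m k : ℕ} (φ : FFormula L K X A (m + 1) k) : FFormula L K X A m k
  | allS {m k : ℕ} (φ : FFormula L K X A m (k + 1)) : FFormula L K X A m k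
  | exS {m k : ℕ} (φ : FFormula L K X A m (k + 1)) : FFormula L K X A m k

/-- The class `H` of the formulas in `F` without quantifiers of sort `S`. -/
def FFormula.IsH {L : FirstOrder.Language.{u, v}} {K : ℕ → Type w} {X : Type x} [TopologicalSpace X]
    {A : Type y} : {m k : ℕ} → FFormula L K X A m k → Prop
  | _, _, .home _ => True
  | _, _, .mem _ _ => True
  | _, _, .and φ ψ => φ.IsH ∧ ψ.IsH
  | _, _, .or φ ψ => φ.IsH ∧ ψ.IsH
  | _, _, .allH φ => φ.IsH
  | _, _, .exH φ => φ.IsH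
  | _, _, .allS _ => False
  | _, _, .exS _ => False

/-- `Approx φ' φ` says that `φ'` is an approximation of `φ`, i.e. that `φ'` is obtained from `φ` by
replacing every atomic `t ∈ C` by `t ∈ C'` for some closed neighbourhood `C'` of `C`. -/
inductive Approx {L : FirstOrder.Language.{u, v}} {K : ℕ → Type w} {X : Type x} [TopologicalSpace X]
    {A : Type y} : {m k : ℕ} → FFormula L K X A m k → FFormula L K X A m k → Prop
  | home {m k : ℕ} (φ : L.BoundedFormula A m) :
      Approx (FFormula.home φ : FFormula L K X A m k) (FFormula.home φ)
  | mem {m k n : ℕ} (t : Fin (n + 1) → STerm L K X (A ⊕ Fin m) (Fin k))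
      (C C' : TopologicalSpace.Closeds (Fin (n + 1) → X))
      (h : (C' : Set (Fin (n + 1) → X)) ∈ 𝓝ˢ (C : Set (Fin (n + 1) → X))) :
      Approx (FFormula.mem t C') (FFormula.mem t C)
  | and {m k : ℕ} {φ φ' ψ ψ' : FFormula L K X A m k} :
      Approx φ' φ → Approx ψ' ψ → Approx (FFormula.and φ' ψ') (FFormula.and φ ψ)
  | or {m k : ℕ} {φ φ' ψ ψ' : FFormula L K X A m k} :
      Approx φ' φ → Approx ψ' ψ → Approx (FFormula.or φ' ψ') (FFormula.or φ ψ)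
  | allH {m k : ℕ} {φ φ' : FFormula L K X A (m + 1) k} :
      Approx φ' φ → Approx (FFormula.allH φ') (FFormula.allH φ)
  | exH {m k : ℕ} {φ φ' : FFormula L K X A (m + 1) k} :
      Approx φ' φ → Approx (FFormula.exH φ') (FFormula.exH φ)
  | allS {m k : ℕ} {φ φ' : FFormula L K X A m (k + 1)} :
      Approx φ' φ → Approx (FFormula.allS φ') (FFormula.allS φ)
  | exS {m k : ℕ} {φ φ' : FFormula L K X A m (k + 1)} :
      Approx φ' φ → Approx (FFormula.exS φ') (FFormula.exS φ)

/-- An interpretation in `M` of the function symbols of sort `H^(n+1) → S`.  A standard structure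
`⟨M, X⟩` is given by `[L.Structure M] [MixedStructure K X M]`, since the symbols of the language of
`X` have their fixed interpretation. -/
class MixedStructure (K : ℕ → Type w) (X : Type x) (M : Type y) where
  funMap {n : ℕ} : K n → (Fin (n + 1) → M) → X

/-- A substructure carries the restrictions of the functions of sort `H^(n+1) → S`. -/
instance (L : FirstOrder.Language.{u, v}) (K : ℕ → Type w) (X : Type x) (M : Type y) [L.Structure M]
    [MixedStructure K X M] (S : L.Substructure M) : MixedStructure K X S where
  funMap f a := MixedStructure.funMap f (fun i => (a i : M))

/-- The value of a term of sort `S` in a standard structure. -/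
def STerm.realize {L : FirstOrder.Language.{u, v}} {K : ℕ → Type w} {X : Type x} [TopologicalSpace X]
    {α : Type y} {β : Type z} {M : Type*} [L.Structure M] [MixedStructure K X M]
    (a : α → M) (ξ : β → X) : STerm L K X α β → X
  | .var i => ξ i
  | .space f ts => f (fun i => (ts i).realize a ξ)
  | .mixed f ts => MixedStructure.funMap f (fun i => (ts i).realize a)

/-- `φ.Realize c a ξ` says that `φ(a ; ξ)` holds in the standard structure `⟨M, X⟩`, when each name is
interpreted according to `c`. -/
def FFormula.Realize {L : FirstOrder.Language.{u, v}} {K : ℕ → Type w} {X : Type x} [TopologicalSpace X]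
    {A : Type y} {M : Type*} [L.Structure M] [MixedStructure K X M] (c : A → M) :
    {m k : ℕ} → FFormula L K X A m k → (Fin m → M) → (Fin k → X) → Prop
  | _, _, .home φ, a, _ => φ.Realize c a
  | _, _, .mem t C, a, ξ => (fun i => (t i).realize (Sum.elim c a) ξ) ∈ C
  | _, _, .and φ ψ, a, ξ => φ.Realize c a ξ ∧ ψ.Realize c a ξ
  | _, _, .or φ ψ, a, ξ => φ.Realize c a ξ ∨ ψ.Realize c a ξ
  | _, _, .allH φ, a, ξ => ∀ b : M, φ.Realize c (Fin.snoc a b) ξ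
  | _, _, .exH φ, a, ξ => ∃ b : M, φ.Realize c (Fin.snoc a b) ξ
  | _, _, .allS φ, a, ξ => ∀ b : X, φ.Realize c a (Fin.snoc ξ b)
  | _, _, .exS φ, a, ξ => ∃ b : X, φ.Realize c a (Fin.snoc ξ b)

/-- `M` is `κ`-`F`-saturated: every type `p(x ; η) ⊆ F(M)` with fewer than `κ` parameters which is
finitely realized in `M` is realized in `M`. -/
def IsFSaturatedOf (L : FirstOrder.Language.{u, v}) (K : ℕ → Type w) (X : Type x) [TopologicalSpace X]
    (κ : Cardinal.{y}) (M : Type y) [L.Structure M] [MixedStructure K X M] : Prop :=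
  ∀ (A : Set M), Cardinal.mk A < κ → ∀ (m k : ℕ) (p : Set (FFormula L K X A m k)),
    (∀ q : Set (FFormula L K X A m k), q ⊆ p → q.Finite →
      ∃ (a : Fin m → M) (ξ : Fin k → X), ∀ φ ∈ q, φ.Realize Subtype.val a ξ) →
    ∃ (a : Fin m → M) (ξ : Fin k → X), ∀ φ ∈ p, φ.Realize Subtype.val a ξ

/-- `M` is `F`-saturated, that is, `|M|`-`F`-saturated. -/
def IsFSaturated (L : FirstOrder.Language.{u, v}) (K : ℕ → Type w) (X : Type x) [TopologicalSpace X]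
    (M : Type y) [L.Structure M] [MixedStructure K X M] : Prop :=
  IsFSaturatedOf L K X (Cardinal.mk M) M

/-- A total map between standard structures is an `F`-elementary embedding if it preserves the truth
of the formulas `φ(x) ∈ F`. -/
def IsFElementary (L : FirstOrder.Language.{u, v}) (K : ℕ → Type w) (X : Type x) [TopologicalSpace X]
    {M : Type y} {N : Type z} [L.Structure M] [MixedStructure K X M] [L.Structure N]
    [MixedStructure K X N] (f : M → N) : Prop :=
  ∀ (m : ℕ) (φ : FFormula L K X Empty m 0) (a : Fin m → M),
    φ.Realize Empty.elim a Fin.elim0 → φ.Realize Empty.elim (f ∘ a) Fin.elim0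

/-- The set `M` is the domain of an `F`-elementary substructure of `U`: it is the domain of a
substructure in the language of the home sort, and the inclusion into `U` of the standard structure
it carries (with the restricted interpretations) is an `F`-elementary embedding. -/
def IsModel (L : FirstOrder.Language.{u, v}) (K : ℕ → Type w) (X : Type x) [TopologicalSpace X]
    {U : Type y} [L.Structure U] [MixedStructure K X U] (M : Set U) : Prop :=
  ∃ S : L.Substructure U, (S : Set U) = M ∧ IsFElementary L K X (Subtype.val : S → U)

/-- The witness condition for the class `H`, for formulas `φ(x)` in a tuple `x` of `m` variables of
sort `H`, without free variables of sort `S`: if `φ(x) ∈ H(M)` has a solution in `U`, then each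
approximation of `φ(x)` has a solution in `M`.  Truth is evaluated in `U`. -/
def HWitness (L : FirstOrder.Language.{u, v}) (K : ℕ → Type w) (X : Type x) [TopologicalSpace X]
    {U : Type y} [L.Structure U] [MixedStructure K X U] (M : Set U) (m : ℕ) : Prop :=
  ∀ φ : FFormula L K X M m 0, φ.IsH →
    (∃ b : Fin m → U, φ.Realize Subtype.val b Fin.elim0) →
    ∀ φ' : FFormula L K X M m 0, Approx φ' φ →
      ∃ a : Fin m → U, (∀ i, a i ∈ M) ∧ φ'.Realize Subtype.val a Fin.elim0

/-- The witness condition for negations of formulas of the class `F`, for formulas `φ(x)` in a tuple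
`x` of `m` variables of sort `H`, without free variables of sort `S`: if the negation of
`φ(x) ∈ F(M)` has a solution in `U`, then it has one in `M`.  Truth is evaluated in `U`. -/
def FWitness (L : FirstOrder.Language.{u, v}) (K : ℕ → Type w) (X : Type x) [TopologicalSpace X]
    {U : Type y} [L.Structure U] [MixedStructure K X U] (M : Set U) (m : ℕ) : Prop :=
  ∀ φ : FFormula L K X M m 0,
    (∃ b : Fin m → U, ¬ φ.Realize Subtype.val b Fin.elim0) →
      ∃ a : Fin m → U, (∀ i, a i ∈ M) ∧ ¬ φ.Realize Subtype.val a Fin.elim0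

end TwoSorted

/-!
The conditions are compared through a Tarski–Vaught test for the class `F` (`TarskiVaughtTest`): if
`¬ φ(g, x ; ξ)`, with `φ ∈ F`, `g` a tuple from `M` and `ξ` a tuple of points of `X`, is satisfied in
`U`, then it is satisfied by an element of `M`.  Names can be traded for variables and points of `X`
can be substituted for space-sort variables, so the test gives the witness condition `FWitness` for
tuples of any length, and it gives `IsModel` by induction on formulas.

As `F` has no negation, passing between `φ` and `¬ φ` uses approximations.

* For `φ' > φ` there is a formula `ψ` of `F`, the formal dual of `φ`, with `¬ φ' → ψ`, and an
  approximation of `ψ` that implies `¬ φ` (`Approx.exists_strong_negation`).  Hence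
  `FWitness` implies `HWitness`.
* In an infinite saturated structure a formula all of whose approximations hold is itself true
  (`IsFSaturated.realize_of_forall_approx`).  If `M` is a model, and `φ(g, x ; ξ)` holds in `U` on all
  of `M`, then, by strong negation, `M` satisfies `∀ x φ'(g, x ; ξ)` for every `φ' > φ`, and so does
  `U`; thus `U` satisfies `∀ x φ(g, x ; ξ)`.
* For `φ' > φ` there are `θ ∈ H` and an approximation `θ'` of `θ` with `φ → θ` and `θ' → φ'`
  (`Approx.exists_isH_between`).  Terms are equicontinuous in their space-sort variables, since the
  functions from the home sort to `X` do not depend on these and `X` is compact; so a quantifier of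
  sort `S` can be replaced by a finite disjunction or conjunction over points of `X`.  Together with
  the two preceding facts, this shows that the witness condition for `H` in one variable implies the
  Tarski–Vaught test.
-/

namespace TwoSorted

variable {L : FirstOrder.Language.{u, v}} {K : ℕ → Type w} {X : Type x}

section Approximation

variable [TopologicalSpace X]

/-! ### Substitution of names and points for variables -/

/-- Replace the home-sort variables of a term along `σ`, and each space-sort variable by a point of
`X` (through the symbol of arity zero that names it) or by another variable, along `τ`. -/
def STerm.subst {α α' : Type*} {β β' : Type*} (σ : α → α') (τ : β → X ⊕ β') :
    STerm L K X α β → STerm L K X α' β'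
  | .var i => Sum.elim (fun p => .space (n := 0) (ContinuousMap.const _ p) Fin.elim0) .var (τ i)
  | .space f ts => .space f fun i => (ts i).subst σ τ
  | .mixed f ts => .mixed f fun i => (ts i).relabel σ

theorem STerm.realize_subst {α α' : Type*} {β β' : Type*} (σ : α → α') (τ : β → X ⊕ β')
    {N : Type*} [L.Structure N] [MixedStructure K X N] (a : α' → N) (ξ : β' → X)
    (t : STerm L K X α β) :
    (t.subst σ τ).realize a ξ = t.realize (a ∘ σ) (Sum.elim id ξ ∘ τ) := by
  induction t with
  | var i =>
    simp only [STerm.subst, STerm.realize, Function.comp_apply]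
    cases τ i <;> simp [STerm.realize]
  | space f ts ih => simp [STerm.subst, STerm.realize, ih]
  | mixed f ts => simp [STerm.subst, STerm.realize]

/-- Extend a substitution of home-sort names and variables below a quantifier of sort `H`. -/
def liftHome {A B : Type*} {m m' : ℕ} (σ : A ⊕ Fin m → B ⊕ Fin m') :
    A ⊕ Fin (m + 1) → B ⊕ Fin (m' + 1) :=
  Sum.elim (fun a => Sum.map id Fin.castSucc (σ (.inl a)))
    (Fin.snoc (α := fun _ => B ⊕ Fin (m' + 1))
      (fun i => Sum.map id Fin.castSucc (σ (.inr i))) (.inr (Fin.last m')))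

/-- Extend a substitution of space-sort variables below a quantifier of sort `S`. -/
def liftSpace {X : Type*} {k k' : ℕ} (τ : Fin k → X ⊕ Fin k') : Fin (k + 1) → X ⊕ Fin (k' + 1) :=
  Fin.snoc (α := fun _ => X ⊕ Fin (k' + 1))
    (fun i => Sum.map id Fin.castSucc (τ i)) (.inr (Fin.last k'))

theorem sumElim_snoc_comp_liftHome {A B N : Type*} {m m' : ℕ} (σ : A ⊕ Fin m → B ⊕ Fin m')
    (c : B → N) (a : Fin m' → N) (b : N) :
    Sum.elim c (Fin.snoc (α := fun _ => N) a b) ∘ liftHome σ =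
      Sum.elim (Sum.elim c a ∘ σ ∘ Sum.inl)
        (Fin.snoc (α := fun _ => N) (Sum.elim c a ∘ σ ∘ Sum.inr) b) := by
  have key (s : B ⊕ Fin m') : Sum.elim c (Fin.snoc (α := fun _ => N) a b)
      (Sum.map id Fin.castSucc s) = Sum.elim c a s := by cases s <;> simp
  funext s
  rcases s with s | i
  · simp only [liftHome, Function.comp_apply, Sum.elim_inl, key]
  · refine Fin.lastCases ?_ (fun j => ?_) i
    · simp [liftHome]
    · simp only [liftHome, Function.comp_apply, Sum.elim_inr, Fin.snoc_castSucc, key]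

theorem sumElim_snoc_comp_liftSpace {X : Type*} {k k' : ℕ} (τ : Fin k → X ⊕ Fin k')
    (ξ : Fin k' → X) (p : X) :
    Sum.elim id (Fin.snoc (α := fun _ => X) ξ p) ∘ liftSpace τ =
      Fin.snoc (α := fun _ => X) (Sum.elim id ξ ∘ τ) p := by
  have key (s : X ⊕ Fin k') : Sum.elim id (Fin.snoc (α := fun _ => X) ξ p)
      (Sum.map id Fin.castSucc s) = Sum.elim id ξ s := by cases s <;> simp
  funext i
  refine Fin.lastCases ?_ (fun j => ?_) i
  · simp [liftSpace]
  · simp only [liftSpace, Function.comp_apply, Fin.snoc_castSucc, key]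

/-- Simultaneous substitution in a formula: names and home-sort variables are replaced by names or
variables along `σ`, and space-sort variables by points of `X` or variables along `τ`. -/
def FFormula.subst {A B : Type*} : {m k m' k' : ℕ} → (A ⊕ Fin m → B ⊕ Fin m') →
    (Fin k → X ⊕ Fin k') → FFormula L K X A m k → FFormula L K X B m' k'
  | _, _, m', _, σ, _, .home φ =>
    .home (FirstOrder.Language.BoundedFormula.relabel (n := m') (k := 0) σ φ.toFormula)
  | _, _, _, _, σ, τ, .mem t C => .mem (fun i => (t i).subst σ τ) C
  | _, _, _, _, σ, τ, .and φ ψ => .and (φ.subst σ τ) (ψ.subst σ τ)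
  | _, _, _, _, σ, τ, .or φ ψ => .or (φ.subst σ τ) (ψ.subst σ τ)
  | _, _, _, _, σ, τ, .allH φ => .allH (φ.subst (liftHome σ) τ)
  | _, _, _, _, σ, τ, .exH φ => .exH (φ.subst (liftHome σ) τ)
  | _, _, _, _, σ, τ, .allS φ => .allS (φ.subst σ (liftSpace τ))
  | _, _, _, _, σ, τ, .exS φ => .exS (φ.subst σ (liftSpace τ))

theorem FFormula.realize_subst {A B : Type*} {N : Type*} [L.Structure N] [MixedStructure K X N]
    (c : B → N) {m k : ℕ} (φ : FFormula L K X A m k) :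
    ∀ {m' k' : ℕ} (σ : A ⊕ Fin m → B ⊕ Fin m') (τ : Fin k → X ⊕ Fin k') (a : Fin m' → N)
      (ξ : Fin k' → X), (φ.subst σ τ).Realize c a ξ ↔
        φ.Realize (Sum.elim c a ∘ σ ∘ Sum.inl) (Sum.elim c a ∘ σ ∘ Sum.inr)
          (Sum.elim id ξ ∘ τ) := by
  induction φ with
  | home φ =>
    intro m' k' σ τ a ξ
    simp only [FFormula.subst, FFormula.Realize]
    refine FirstOrder.Language.BoundedFormula.realize_relabel.trans ?_
    refine (iff_of_eq (congrArg (FirstOrder.Language.BoundedFormula.Realize φ.toFormula _)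
      (Subsingleton.elim _ default))).trans ?_
    refine (FirstOrder.Language.BoundedFormula.realize_toFormula φ _).trans ?_
    rfl
  | mem t C =>
    intro m' k' σ τ a ξ
    simp only [FFormula.subst, FFormula.Realize, STerm.realize_subst]
    rw [← Sum.elim_comp_inl_inr (Sum.elim _ a ∘ σ)]
    rfl
  | and φ ψ ih₁ ih₂ => intros; simp only [FFormula.subst, FFormula.Realize, ih₁, ih₂]
  | or φ ψ ih₁ ih₂ => intros; simp only [FFormula.subst, FFormula.Realize, ih₁, ih₂]
  | allH φ ih =>
    intro m' k' σ τ a ξ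
    simp only [FFormula.subst, FFormula.Realize, ih]
    simp only [← Function.comp_assoc, sumElim_snoc_comp_liftHome, Sum.elim_comp_inl,
      Sum.elim_comp_inr]
  | exH φ ih =>
    intro m' k' σ τ a ξ
    simp only [FFormula.subst, FFormula.Realize, ih]
    simp only [← Function.comp_assoc, sumElim_snoc_comp_liftHome, Sum.elim_comp_inl,
      Sum.elim_comp_inr]
  | allS φ ih =>
    intros
    simp only [FFormula.subst, FFormula.Realize, ih, sumElim_snoc_comp_liftSpace]
  | exS φ ih =>
    intros
    simp only [FFormula.subst, FFormula.Realize, ih, sumElim_snoc_comp_liftSpace]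

theorem FFormula.IsH.subst {A B : Type*} {m k : ℕ} {φ : FFormula L K X A m k} (h : φ.IsH) :
    ∀ {m' k' : ℕ} (σ : A ⊕ Fin m → B ⊕ Fin m') (τ : Fin k → X ⊕ Fin k'), (φ.subst σ τ).IsH := by
  induction φ with
  | home | mem => intros; trivial
  | and φ ψ ih₁ ih₂ => exact fun σ τ => ⟨ih₁ h.1 σ τ, ih₂ h.2 σ τ⟩
  | or φ ψ ih₁ ih₂ => exact fun σ τ => ⟨ih₁ h.1 σ τ, ih₂ h.2 σ τ⟩
  | allH φ ih => exact fun σ τ => ih h (liftHome σ) τ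
  | exH φ ih => exact fun σ τ => ih h (liftHome σ) τ
  | allS | exS => exact h.elim

theorem Approx.subst {A B : Type*} {m k : ℕ} {φ φ' : FFormula L K X A m k} (h : Approx φ' φ) :
    ∀ {m' k' : ℕ} (σ : A ⊕ Fin m → B ⊕ Fin m') (τ : Fin k → X ⊕ Fin k'),
      Approx (φ'.subst σ τ) (φ.subst σ τ) := by
  induction h with
  | home φ => exact fun σ τ => .home _
  | mem t C C' h => exact fun σ τ => .mem _ C C' h
  | and _ _ ih₁ ih₂ => exact fun σ τ => .and (ih₁ σ τ) (ih₂ σ τ)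
  | or _ _ ih₁ ih₂ => exact fun σ τ => .or (ih₁ σ τ) (ih₂ σ τ)
  | allH _ ih => exact fun σ τ => .allH (ih (liftHome σ) τ)
  | exH _ ih => exact fun σ τ => .exH (ih (liftHome σ) τ)
  | allS _ ih => exact fun σ τ => .allS (ih σ (liftSpace τ))
  | exS _ ih => exact fun σ τ => .exS (ih σ (liftSpace τ))

/-- `φ(g, x₀, …, x_{j-1} ; ξ)`: the first `n` home-sort variables of a parameter-free formula are
replaced by names, and all its space-sort variables by points of `X`. -/
def FFormula.inst {A : Type*} {n j k : ℕ} (g : Fin n → A) (ξ : Fin k → X)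
    (φ : FFormula L K X Empty (n + j) k) : FFormula L K X A j 0 :=
  φ.subst (Sum.elim Empty.elim (Fin.append (Sum.inl ∘ g) Sum.inr)) (Sum.inl ∘ ξ)

theorem FFormula.realize_inst {A : Type*} {N : Type*} [L.Structure N] [MixedStructure K X N]
    (c : A → N) {n j k : ℕ} (g : Fin n → A) (ξ : Fin k → X)
    (φ : FFormula L K X Empty (n + j) k) (a : Fin j → N) :
    (φ.inst g ξ).Realize c a Fin.elim0 ↔ φ.Realize Empty.elim (Fin.append (c ∘ g) a) ξ := by
  rw [FFormula.inst, FFormula.realize_subst]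
  refine iff_of_eq ?_
  congr 1
  · exact Subsingleton.elim _ _
  · funext i
    refine Fin.addCases (fun i => ?_) (fun i => ?_) i <;> simp

/-- `φ(x ; η, p)`: the last space-sort variable is replaced by the point `p`. -/
def FFormula.instSpace {A : Type*} {m k : ℕ} (p : X) (φ : FFormula L K X A m (k + 1)) :
    FFormula L K X A m k :=
  φ.subst id (Fin.snoc (α := fun _ => X ⊕ Fin k) Sum.inr (Sum.inl p))

theorem FFormula.realize_instSpace {A : Type*} {N : Type*} [L.Structure N] [MixedStructure K X N]
    (c : A → N) {m k : ℕ} (p : X) (φ : FFormula L K X A m (k + 1)) (a : Fin m → N)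
    (ξ : Fin k → X) :
    (φ.instSpace p).Realize c a ξ ↔ φ.Realize c a (Fin.snoc ξ p) := by
  rw [FFormula.instSpace, FFormula.realize_subst]
  refine iff_of_eq ?_
  congr 1
  funext i
  refine Fin.lastCases ?_ (fun i => ?_) i <;> simp

/-! ### Removing names -/

theorem STerm.exists_finite_support {A : Type*} {β : Type*} {m : ℕ}
    (t : STerm L K X (A ⊕ Fin m) β) :
    ∃ s : Set A, s.Finite ∧ ∀ (N : Type y) [L.Structure N] [MixedStructure K X N] (c c' : A → N),
      Set.EqOn c c' s → ∀ a ξ, t.realize (Sum.elim c a) ξ = t.realize (Sum.elim c' a) ξ := by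
  induction t with
  | var i => exact ⟨∅, Set.finite_empty, fun N _ _ c c' _ a ξ => rfl⟩
  | space f ts ih =>
    choose s hs h using ih
    refine ⟨⋃ i, s i, Set.finite_iUnion hs, fun N _ _ c c' hc a ξ => ?_⟩
    simp only [STerm.realize]
    congr 1
    funext i
    exact h i N c c' (hc.mono (Set.subset_iUnion s i)) a ξ
  | mixed f ts =>
    classical
    refine ⟨⋃ i, ((ts i).varFinsetLeft : Set A),
      Set.finite_iUnion fun i => Finset.finite_toSet _, fun N _ _ c c' hc a ξ => ?_⟩
    simp only [STerm.realize]
    congr 1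
    funext i
    have hi : Set.EqOn c c' ((ts i).varFinsetLeft : Set A) :=
      hc.mono (Set.subset_iUnion (fun i => ((ts i).varFinsetLeft : Set A)) i)
    generalize ts i = t at hi
    clear hc
    induction t with
    | var j =>
      rcases j with j | j
      · exact hi (by simp [FirstOrder.Language.Term.varFinsetLeft])
      · rfl
    | func f ts ih =>
      simp only [FirstOrder.Language.Term.realize]
      congr 1
      funext i
      exact ih i (hi.mono (by
        intro b hb
        simp only [FirstOrder.Language.Term.varFinsetLeft, Finset.coe_biUnion, Set.mem_iUnion]
        exact ⟨i, by simp, hb⟩))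

theorem FFormula.exists_finite_support {A : Type*} {m k : ℕ} (φ : FFormula L K X A m k) :
    ∃ s : Set A, s.Finite ∧ ∀ (N : Type y) [L.Structure N] [MixedStructure K X N] (c c' : A → N),
      Set.EqOn c c' s → ∀ a ξ, φ.Realize c a ξ ↔ φ.Realize c' a ξ := by
  induction φ with
  | home φ =>
    classical
    refine ⟨φ.freeVarFinset, Finset.finite_toSet _, fun N _ _ c c' hc a ξ => ?_⟩
    simp only [FFormula.Realize]
    rw [← FirstOrder.Language.BoundedFormula.realize_restrictFreeVar' (Set.Subset.refl _),
      ← FirstOrder.Language.BoundedFormula.realize_restrictFreeVar' (Set.Subset.refl _) (v := c')]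
    exact iff_of_eq (congrArg (fun d => FirstOrder.Language.BoundedFormula.Realize _ d a)
      (funext fun i => hc i.2))
  | mem t C =>
    choose s hs h using fun i => (t i).exists_finite_support
    refine ⟨⋃ i, s i, Set.finite_iUnion hs, fun N _ _ c c' hc a ξ => ?_⟩
    have e := funext fun i => h i N c c' (hc.mono (Set.subset_iUnion s i)) a ξ
    simp only [FFormula.Realize, e]
  | and φ ψ ih₁ ih₂ | or φ ψ ih₁ ih₂ =>
    obtain ⟨s, hs, h⟩ := ih₁
    obtain ⟨s', hs', h'⟩ := ih₂
    refine ⟨s ∪ s', hs.union hs', fun N _ _ c c' hc a ξ => ?_⟩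
    simp only [FFormula.Realize, h N c c' (hc.mono Set.subset_union_left),
      h' N c c' (hc.mono Set.subset_union_right)]
  | allH φ ih | exH φ ih | allS φ ih | exS φ ih =>
    obtain ⟨s, hs, h⟩ := ih
    refine ⟨s, hs, fun N _ _ c c' hc a ξ => ?_⟩
    simp only [FFormula.Realize, h N c c' hc]

/-- The finitely many names in a formula can be replaced by new leading variables. -/
theorem FFormula.exists_eq_inst {A : Type*} {m k : ℕ} (φ : FFormula L K X A m k) :
    ∃ (n : ℕ) (g : Fin n → A) (φ₀ : FFormula L K X Empty (n + m) k),
      ∀ (N : Type y) [L.Structure N] [MixedStructure K X N] (c : A → N) a ξ,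
        φ.Realize c a ξ ↔ φ₀.Realize Empty.elim (Fin.append (c ∘ g) a) ξ := by
  obtain ⟨s, hs, h⟩ := φ.exists_finite_support
  obtain ⟨n, g, r, hr⟩ : ∃ (n : ℕ) (g : Fin n → A) (r : A → Fin n), ∀ a ∈ s, g (r a) = a := by
    rcases isEmpty_or_nonempty A with hA | ⟨⟨a₀⟩⟩
    · exact ⟨0, Fin.elim0, isEmptyElim, isEmptyElim⟩
    · have hfin := hs.insert a₀
      have := hfin.to_subtype
      obtain ⟨n, ⟨e⟩⟩ := Finite.exists_equiv_fin (insert a₀ s : Set A)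
      classical
      refine ⟨n, fun i => e.symm i, fun a => if ha : a ∈ s then e ⟨a, .inr ha⟩ else e ⟨a₀, .inl rfl⟩,
        fun a ha => by simp [ha]⟩
  refine ⟨n, g, φ.subst (Sum.elim (fun a => .inr (Fin.castAdd m (r a)))
    (fun i => .inr (Fin.natAdd n i))) Sum.inr, fun N _ _ c a ξ => ?_⟩
  rw [FFormula.realize_subst]
  refine (h N c (c ∘ g ∘ r) (fun b hb => by simp [hr b hb]) a ξ).trans (iff_of_eq ?_)
  congr 1
  · funext b; simp
  · funext i; simp

/-! ### Approximations -/

theorem Approx.realize {A : Type*} {N : Type*} [L.Structure N] [MixedStructure K X N]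
    (c : A → N) {m k : ℕ} {φ φ' : FFormula L K X A m k} (h : Approx φ' φ) :
    ∀ {a ξ}, φ.Realize c a ξ → φ'.Realize c a ξ := by
  induction h with
  | home φ => exact id
  | mem t C C' h => exact fun hC => subset_of_mem_nhdsSet h hC
  | and _ _ ih₁ ih₂ => exact fun h => ⟨ih₁ h.1, ih₂ h.2⟩
  | or _ _ ih₁ ih₂ => exact fun h => h.imp ih₁ ih₂
  | allH _ ih => exact fun h b => ih (h b)
  | exH _ ih => exact fun ⟨b, h⟩ => ⟨b, ih h⟩
  | allS _ ih => exact fun h b => ih (h b)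
  | exS _ ih => exact fun ⟨b, h⟩ => ⟨b, ih h⟩

theorem FFormula.exists_approx {A : Type*} {m k : ℕ} (φ : FFormula L K X A m k) :
    ∃ φ', Approx φ' φ := by
  induction φ with
  | home φ => exact ⟨_, .home φ⟩
  | mem t C => exact ⟨_, .mem t C ⊤ Filter.univ_mem⟩
  | and φ ψ ih₁ ih₂ => exact ⟨_, .and ih₁.choose_spec ih₂.choose_spec⟩
  | or φ ψ ih₁ ih₂ => exact ⟨_, .or ih₁.choose_spec ih₂.choose_spec⟩
  | allH φ ih => exact ⟨_, .allH ih.choose_spec⟩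
  | exH φ ih => exact ⟨_, .exH ih.choose_spec⟩
  | allS φ ih => exact ⟨_, .allS ih.choose_spec⟩
  | exS φ ih => exact ⟨_, .exS ih.choose_spec⟩

/-- Two approximations of a formula have a common refinement. -/
theorem Approx.exists_common {A : Type*} {m k : ℕ} {φ φ₁ φ₂ : FFormula L K X A m k}
    (h₁ : Approx φ₁ φ) : Approx φ₂ φ →
    ∃ φ₃, Approx φ₃ φ ∧ ∀ (N : Type y) [L.Structure N] [MixedStructure K X N] (c : A → N) a ξ,
      φ₃.Realize c a ξ → φ₁.Realize c a ξ ∧ φ₂.Realize c a ξ := by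
  induction h₁ with
  | home φ => rintro ⟨⟩; exact ⟨_, .home φ, fun N _ _ c a ξ h => ⟨h, h⟩⟩
  | mem t C C' h =>
    rintro (_ | ⟨_, _, C'', h'⟩)
    exact ⟨_, .mem t C (C' ⊓ C'') (Filter.inter_mem h h'), fun N _ _ c a ξ h => h⟩
  | and _ _ ih₁ ih₂ =>
    rintro (_ | _ | ⟨k₁, k₂⟩)
    obtain ⟨χ₁, hχ₁, e₁⟩ := ih₁ k₁
    obtain ⟨χ₂, hχ₂, e₂⟩ := ih₂ k₂
    exact ⟨_, .and hχ₁ hχ₂, fun N _ _ c a ξ h =>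
      ⟨⟨(e₁ N c a ξ h.1).1, (e₂ N c a ξ h.2).1⟩, ⟨(e₁ N c a ξ h.1).2, (e₂ N c a ξ h.2).2⟩⟩⟩
  | or _ _ ih₁ ih₂ =>
    rintro (_ | _ | _ | ⟨k₁, k₂⟩)
    obtain ⟨χ₁, hχ₁, e₁⟩ := ih₁ k₁
    obtain ⟨χ₂, hχ₂, e₂⟩ := ih₂ k₂
    exact ⟨_, .or hχ₁ hχ₂, fun N _ _ c a ξ h =>
      ⟨h.imp (fun h => (e₁ N c a ξ h).1) (fun h => (e₂ N c a ξ h).1),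
        h.imp (fun h => (e₁ N c a ξ h).2) (fun h => (e₂ N c a ξ h).2)⟩⟩
  | allH _ ih =>
    rintro (_ | _ | _ | _ | k₁)
    obtain ⟨χ, hχ, e⟩ := ih k₁
    exact ⟨_, .allH hχ, fun N _ _ c a ξ h =>
      ⟨fun b => (e N c _ ξ (h b)).1, fun b => (e N c _ ξ (h b)).2⟩⟩
  | exH _ ih =>
    rintro (_ | _ | _ | _ | _ | k₁)
    obtain ⟨χ, hχ, e⟩ := ih k₁
    exact ⟨_, .exH hχ, fun N _ _ c a ξ ⟨b, h⟩ =>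
      ⟨⟨b, (e N c _ ξ h).1⟩, ⟨b, (e N c _ ξ h).2⟩⟩⟩
  | allS _ ih =>
    rintro (_ | _ | _ | _ | _ | _ | k₁)
    obtain ⟨χ, hχ, e⟩ := ih k₁
    exact ⟨_, .allS hχ, fun N _ _ c a ξ h =>
      ⟨fun b => (e N c a _ (h b)).1, fun b => (e N c a _ (h b)).2⟩⟩
  | exS _ ih =>
    rintro (_ | _ | _ | _ | _ | _ | _ | k₁)
    obtain ⟨χ, hχ, e⟩ := ih k₁
    exact ⟨_, .exS hχ, fun N _ _ c a ξ ⟨b, h⟩ =>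
      ⟨⟨b, (e N c a _ h).1⟩, ⟨b, (e N c a _ h).2⟩⟩⟩

theorem exists_common_approx_of_finite {A : Type*} {m k : ℕ} (φ : FFormula L K X A m k)
    {q : Set (FFormula L K X A m k)} (hq : q.Finite) (h : ∀ φ' ∈ q, Approx φ' φ) :
    ∃ φ₃, Approx φ₃ φ ∧ ∀ (N : Type y) [L.Structure N] [MixedStructure K X N] (c : A → N) a ξ,
      φ₃.Realize c a ξ → ∀ φ' ∈ q, φ'.Realize c a ξ := by
  induction q, hq using Set.Finite.induction_on with
  | empty =>
    obtain ⟨φ', h⟩ := φ.exists_approx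
    exact ⟨φ', h, fun N _ _ c a ξ _ φ' h => h.elim⟩
  | insert _ _ ih =>
    obtain ⟨χ, hχ, e⟩ := ih fun φ' h' => h φ' (.inr h')
    obtain ⟨χ', hχ', e'⟩ := hχ.exists_common (h _ (.inl rfl))
    refine ⟨χ', hχ', fun N _ _ c a ξ hr φ' h' => ?_⟩
    rcases h' with rfl | h'
    · exact (e' N c a ξ hr).2
    · exact e N c a ξ (e' N c a ξ hr).1 φ' h'

theorem exists_closeds_between {Y : Type*} [TopologicalSpace Y] [NormalSpace Y]
    (C C' : TopologicalSpace.Closeds Y) (h : (C' : Set Y) ∈ 𝓝ˢ (C : Set Y)) :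
    ∃ D : TopologicalSpace.Closeds Y, (D : Set Y) ∈ 𝓝ˢ (C : Set Y) ∧
      (C' : Set Y) ∈ 𝓝ˢ (D : Set Y) := by
  obtain ⟨V, hV, hCV, hVC⟩ := normal_exists_closure_subset C.isClosed isOpen_interior
    (subset_interior_iff_mem_nhdsSet.2 h)
  exact ⟨⟨closure V, isClosed_closure⟩,
    Filter.mem_of_superset (hV.mem_nhdsSet.2 hCV) subset_closure,
    subset_interior_iff_mem_nhdsSet.1 hVC⟩

theorem Approx.exists_between [CompactSpace X] [T2Space X] {A : Type*} {m k : ℕ}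
    {φ φ' : FFormula L K X A m k} (h : Approx φ' φ) : ∃ χ, Approx χ φ ∧ Approx φ' χ := by
  induction h with
  | home φ => exact ⟨_, .home φ, .home φ⟩
  | mem t C C' h =>
    obtain ⟨D, h₁, h₂⟩ := exists_closeds_between C C' h
    exact ⟨_, .mem t C D h₁, .mem t D C' h₂⟩
  | and _ _ ih₁ ih₂ =>
    obtain ⟨_, h₁, h₂⟩ := ih₁
    obtain ⟨_, h₃, h₄⟩ := ih₂
    exact ⟨_, .and h₁ h₃, .and h₂ h₄⟩
  | or _ _ ih₁ ih₂ =>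
    obtain ⟨_, h₁, h₂⟩ := ih₁
    obtain ⟨_, h₃, h₄⟩ := ih₂
    exact ⟨_, .or h₁ h₃, .or h₂ h₄⟩
  | allH _ ih => obtain ⟨_, h₁, h₂⟩ := ih; exact ⟨_, .allH h₁, .allH h₂⟩
  | exH _ ih => obtain ⟨_, h₁, h₂⟩ := ih; exact ⟨_, .exH h₁, .exH h₂⟩
  | allS _ ih => obtain ⟨_, h₁, h₂⟩ := ih; exact ⟨_, .allS h₁, .allS h₂⟩
  | exS _ ih => obtain ⟨_, h₁, h₂⟩ := ih; exact ⟨_, .exS h₁, .exS h₂⟩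

/-- A substitute for negation in the class `F`: if `φ'` is an approximation of `φ`, then some `ψ`
lies between `¬ φ'` and `¬ φ`, and even an approximation of `ψ` still implies `¬ φ`.  The formula
`ψ` is the formal dual of `φ`, in which `t ∈ C` becomes `t ∉ interior C'`. -/
theorem Approx.exists_strong_negation [CompactSpace X] [T2Space X] {A : Type*} {m k : ℕ}
    {φ φ' : FFormula L K X A m k} (h : Approx φ' φ) :
    ∃ ψ ψ' : FFormula L K X A m k, Approx ψ' ψ ∧
      ∀ (N : Type y) [L.Structure N] [MixedStructure K X N] (c : A → N) a ξ,
        (¬ φ'.Realize c a ξ → ψ.Realize c a ξ) ∧ (ψ'.Realize c a ξ → ¬ φ.Realize c a ξ) := by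
  induction h with
  | home φ =>
    exact ⟨.home φ.not, _, .home _, fun N _ _ c a ξ => by simp [FFormula.Realize]⟩
  | @mem m k n t C C' h =>
    let E : TopologicalSpace.Closeds (Fin (n + 1) → X) :=
      ⟨(interior (C' : Set (Fin (n + 1) → X)))ᶜ, isOpen_interior.isClosed_compl⟩
    obtain ⟨V, hV, hEV, hVC⟩ := normal_exists_closure_subset (s := (E : Set (Fin (n + 1) → X)))
      (t := (C : Set (Fin (n + 1) → X))ᶜ) E.isClosed C.isClosed.isOpen_compl
      (Set.compl_subset_compl.2 (subset_interior_iff_mem_nhdsSet.2 h))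
    refine ⟨_, _, .mem t E ⟨closure V, isClosed_closure⟩
      (Filter.mem_of_superset (hV.mem_nhdsSet.2 hEV) subset_closure), fun N _ _ c a ξ => ⟨?_, ?_⟩⟩
    · exact fun h' h'' => h' (interior_subset h'')
    · exact fun h' => hVC h'
  | and _ _ ih₁ ih₂ =>
    obtain ⟨_, _, h₁, e₁⟩ := ih₁
    obtain ⟨_, _, h₂, e₂⟩ := ih₂
    refine ⟨_, _, .or h₁ h₂, fun N _ _ c a ξ => ⟨fun h' => ?_, fun h' hφ => ?_⟩⟩
    · exact (not_and_or.1 h').imp (e₁ N c a ξ).1 (e₂ N c a ξ).1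
    · exact h'.elim (fun h' => (e₁ N c a ξ).2 h' hφ.1) (fun h' => (e₂ N c a ξ).2 h' hφ.2)
  | or _ _ ih₁ ih₂ =>
    obtain ⟨_, _, h₁, e₁⟩ := ih₁
    obtain ⟨_, _, h₂, e₂⟩ := ih₂
    refine ⟨_, _, .and h₁ h₂, fun N _ _ c a ξ => ⟨fun h' => ?_, fun h' => ?_⟩⟩
    · exact ⟨(e₁ N c a ξ).1 fun h => h' (.inl h), (e₂ N c a ξ).1 fun h => h' (.inr h)⟩
    · exact not_or.2 ⟨(e₁ N c a ξ).2 h'.1, (e₂ N c a ξ).2 h'.2⟩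
  | allH _ ih =>
    obtain ⟨_, _, h, e⟩ := ih
    refine ⟨_, _, .exH h, fun N _ _ c a ξ => ⟨fun h' => ?_, fun ⟨b, hb⟩ h' => ?_⟩⟩
    · obtain ⟨b, hb⟩ := not_forall.1 h'
      exact ⟨b, (e N c _ ξ).1 hb⟩
    · exact (e N c _ ξ).2 hb (h' b)
  | exH _ ih =>
    obtain ⟨_, _, h, e⟩ := ih
    exact ⟨_, _, .allH h, fun N _ _ c a ξ =>
      ⟨fun h' b => (e N c _ ξ).1 fun hb => h' ⟨b, hb⟩, fun h' ⟨b, hb⟩ => (e N c _ ξ).2 (h' b) hb⟩⟩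
  | allS _ ih =>
    obtain ⟨_, _, h, e⟩ := ih
    refine ⟨_, _, .exS h, fun N _ _ c a ξ => ⟨fun h' => ?_, fun ⟨b, hb⟩ h' => ?_⟩⟩
    · obtain ⟨b, hb⟩ := not_forall.1 h'
      exact ⟨b, (e N c a _).1 hb⟩
    · exact (e N c a _).2 hb (h' b)
  | exS _ ih =>
    obtain ⟨_, _, h, e⟩ := ih
    exact ⟨_, _, .allS h, fun N _ _ c a ξ =>
      ⟨fun h' b => (e N c a _).1 fun hb => h' ⟨b, hb⟩, fun h' ⟨b, hb⟩ => (e N c a _).2 (h' b) hb⟩⟩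

end Approximation

/-! ### Saturation -/

/-- In a saturated structure, a formula holds as soon as all its approximations do: each existential
quantifier is witnessed by a realization of the type formed by the approximations of its scope. -/
theorem IsFSaturated.realize_of_forall_approx [TopologicalSpace X] [CompactSpace X] [T2Space X]
    {U : Type y} [L.Structure U] [MixedStructure K X U] [Infinite U] (hU : IsFSaturated L K X U)
    {m k : ℕ} (φ : FFormula L K X Empty m k) :
    ∀ (a : Fin m → U) (ξ : Fin k → X), (∀ φ', Approx φ' φ → φ'.Realize Empty.elim a ξ) →
      φ.Realize Empty.elim a ξ := by
  have hcard {m : ℕ} (a : Fin m → U) : Cardinal.mk (Set.range a) < Cardinal.mk U :=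
    (Cardinal.lt_aleph0_of_finite _).trans_le (Cardinal.aleph0_le_mk U)
  induction φ with
  | home φ => exact fun a ξ h => h _ (.home φ)
  | @mem m k n t C =>
    intro a ξ h
    by_contra hC
    obtain ⟨V, hV, hCV, hVC⟩ := normal_exists_closure_subset C.isClosed
      (isOpen_compl_singleton (x := fun i => (t i).realize (Sum.elim Empty.elim a) ξ))
      (Set.subset_compl_singleton_iff.2 hC)
    exact hVC (h _ (.mem t C ⟨closure V, isClosed_closure⟩
      (Filter.mem_of_superset (hV.mem_nhdsSet.2 hCV) subset_closure))) rfl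
  | and φ ψ ih₁ ih₂ =>
    intro a ξ h
    obtain ⟨φ₀, hφ₀⟩ := φ.exists_approx
    obtain ⟨ψ₀, hψ₀⟩ := ψ.exists_approx
    exact ⟨ih₁ a ξ fun φ' h' => (h _ (.and h' hψ₀)).1,
      ih₂ a ξ fun ψ' h' => (h _ (.and hφ₀ h')).2⟩
  | or φ ψ ih₁ ih₂ =>
    intro a ξ h
    by_contra hn
    obtain ⟨hn₁, hn₂⟩ := not_or.1 hn
    obtain ⟨φ', hφ', hφ⟩ := not_forall₂.1 (mt (ih₁ a ξ) hn₁)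
    obtain ⟨ψ', hψ', hψ⟩ := not_forall₂.1 (mt (ih₂ a ξ) hn₂)
    exact (h _ (.or hφ' hψ')).elim hφ hψ
  | allH φ ih => exact fun a ξ h b => ih _ ξ fun φ' h' => h _ (.allH h') b
  | allS φ ih => exact fun a ξ h b => ih a _ fun φ' h' => h _ (.allS h') b
  | @exH m k φ ih =>
    intro a ξ h
    let g : Fin m → Set.range a := fun i => ⟨a i, i, rfl⟩
    obtain ⟨b, ζ, hb⟩ := hU (Set.range a) (hcard a) 1 0
      ((fun φ' => FFormula.inst (j := 1) g ξ φ') '' {φ' | Approx φ' φ}) (by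
        intro q hqp hq
        obtain ⟨q₀, hq₀, hfin, rfl⟩ :=
          Set.exists_subset_image_finite_and.1 ⟨q, hqp, hq, rfl⟩
        obtain ⟨χ, hχ, e⟩ := exists_common_approx_of_finite φ hfin hq₀
        obtain ⟨b, hb⟩ := h _ (.exH hχ)
        refine ⟨fun _ => b, Fin.elim0, ?_⟩
        rintro _ ⟨φ', hφ', rfl⟩
        rw [FFormula.realize_inst, Fin.append_right_eq_snoc]
        exact e U _ _ _ hb φ' hφ')
    obtain rfl : ζ = Fin.elim0 := Subsingleton.elim _ _
    refine ⟨b 0, ih _ ξ fun φ' h' => ?_⟩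
    have := hb _ ⟨φ', h', rfl⟩
    rw [FFormula.realize_inst,
      Fin.append_right_eq_snoc] at this
    exact this
  | @exS m k φ ih =>
    intro a ξ h
    let σ : Empty ⊕ Fin m → Set.range a ⊕ Fin 0 :=
      Sum.elim Empty.elim fun i => .inl ⟨a i, i, rfl⟩
    let τ : Fin (k + 1) → X ⊕ Fin 1 :=
      Fin.snoc (α := fun _ => X ⊕ Fin 1) (Sum.inl ∘ ξ) (Sum.inr 0)
    have key (φ' : FFormula L K X Empty m (k + 1)) (b : Fin 0 → U) (ζ : Fin 1 → X) :
        (φ'.subst σ τ).Realize Subtype.val b ζ ↔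
          φ'.Realize Empty.elim a (Fin.snoc ξ (ζ 0)) := by
      rw [FFormula.realize_subst]
      refine iff_of_eq ?_
      congr 1
      · exact Subsingleton.elim _ _
      · funext i
        refine Fin.lastCases ?_ (fun i => ?_) i <;> simp [τ]
    obtain ⟨b, ζ, hb⟩ := hU (Set.range a) (hcard a) 0 1
      ((fun φ' => φ'.subst σ τ) '' {φ' | Approx φ' φ}) (by
        intro q hqp hq
        obtain ⟨q₀, hq₀, hfin, rfl⟩ :=
          Set.exists_subset_image_finite_and.1 ⟨q, hqp, hq, rfl⟩
        obtain ⟨χ, hχ, e⟩ := exists_common_approx_of_finite φ hfin hq₀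
        obtain ⟨p, hp⟩ := h _ (.exS hχ)
        refine ⟨Fin.elim0, fun _ => p, ?_⟩
        rintro _ ⟨φ', hφ', rfl⟩
        exact (key φ' _ _).2 (e U _ _ _ hp φ' hφ'))
    exact ⟨ζ 0, ih a _ fun φ' h' => (key φ' b ζ).1 (hb _ ⟨φ', h', rfl⟩)⟩

/-! ### Elimination of quantifiers of sort `S` up to approximation -/

open scoped Uniformity

theorem eventually_forall_mem_uniformity_pi {β ι : Type*} [UniformSpace X] {n : ℕ}
    (l : Filter (β × β)) (F : Fin n → ι → β → X)
    (hF : ∀ i, ∀ V ∈ 𝓤 X, ∀ᶠ q in l, ∀ a, (F i a q.1, F i a q.2) ∈ V) :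
    ∀ V ∈ 𝓤 (Fin n → X), ∀ᶠ q in l, ∀ a, (fun i => F i a q.1, fun i => F i a q.2) ∈ V := by
  intro V hV
  rw [Pi.uniformity] at hV
  obtain ⟨W, hW, rfl⟩ := (Filter.mem_iInf_of_finite _).1 hV
  choose T hT hTW using fun i => Filter.mem_comap.1 (hW i)
  filter_upwards [Filter.eventually_all.2 fun i => hF i (T i) (hT i)] with q hq a
  exact Set.mem_iInter.2 fun i => hTW i (hq i a)

/-- The values of a term are equicontinuous functions of its space-sort variables, uniformly in the
home-sort ones: the symbols of sort `H^(n+1) → S` do not see the space-sort variables, and continuous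
functions on a compact space are uniformly continuous. -/
theorem STerm.eventually_realize_mem_uniformity [UniformSpace X] [CompactSpace X] {α : Type*}
    {k : ℕ} (N : Type*) [L.Structure N] [MixedStructure K X N] (t : STerm L K X α (Fin k)) :
    ∀ V ∈ 𝓤 X, ∀ᶠ q in 𝓤 (Fin k → X), ∀ a : α → N, (t.realize a q.1, t.realize a q.2) ∈ V := by
  induction t with
  | var i =>
    intro V hV
    filter_upwards [Pi.uniformContinuous_proj (fun _ : Fin k => X) i hV] with q hq a
    exact hq
  | space f ts ih =>
    intro V hV
    exact eventually_forall_mem_uniformity_pi _ (fun i a ξ => (ts i).realize a ξ) ih _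
      (CompactSpace.uniformContinuous_of_continuous f.continuous hV)
  | mixed f ts => exact fun V hV => .of_forall fun q a => refl_mem_uniformity hV

theorem Approx.eventually_realize [UniformSpace X] [CompactSpace X] {A : Type*} {N : Type*}
    [L.Structure N] [MixedStructure K X N] (c : A → N) {m k : ℕ} {φ φ' : FFormula L K X A m k}
    (h : Approx φ' φ) (hφ : φ.IsH) :
    ∀ᶠ q in 𝓤 (Fin k → X), ∀ a, φ.Realize c a q.1 → φ'.Realize c a q.2 := by
  induction h with
  | home φ => exact .of_forall fun q a h => h
  | mem t C C' h =>
    obtain ⟨V, hV, hVC⟩ :=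
      (C.isClosed.isCompact.nhdsSet_basis_uniformity (Filter.basis_sets _)).mem_iff.1 h
    filter_upwards [eventually_forall_mem_uniformity_pi _
      (fun i a ξ => (t i).realize (Sum.elim c a) ξ) (fun i W hW =>
        ((t i).eventually_realize_mem_uniformity N W hW).mono fun q hq a => hq _) V hV] with q hq a ha
    exact hVC (Set.mem_biUnion ha (hq a))
  | and _ _ ih₁ ih₂ =>
    filter_upwards [ih₁ hφ.1, ih₂ hφ.2] with q h₁ h₂ a h
    exact ⟨h₁ a h.1, h₂ a h.2⟩
  | or _ _ ih₁ ih₂ =>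
    filter_upwards [ih₁ hφ.1, ih₂ hφ.2] with q h₁ h₂ a h
    exact h.imp (h₁ a) (h₂ a)
  | allH _ ih =>
    filter_upwards [ih hφ] with q hq a h b
    exact hq _ (h b)
  | exH _ ih =>
    filter_upwards [ih hφ] with q hq a
    rintro ⟨b, h⟩
    exact ⟨b, hq _ h⟩
  | allS | exS => exact hφ.elim

theorem Approx.isH {A : Type*} [TopologicalSpace X] {m k : ℕ} {φ φ' : FFormula L K X A m k}
    (h : Approx φ' φ) (hφ : φ.IsH) : φ'.IsH := by
  induction h with
  | home | mem => trivial
  | and _ _ ih₁ ih₂ | or _ _ ih₁ ih₂ => exact ⟨ih₁ hφ.1, ih₂ hφ.2⟩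
  | allH _ ih | exH _ ih => exact ih hφ
  | allS | exS => exact hφ.elim

/-- Up to approximation, the last space-sort variable of a formula in the class `H` only needs to
range over a finite set of points, uniformly in all the other variables. -/
theorem Approx.exists_finset_points [TopologicalSpace X] [CompactSpace X] [T2Space X] {A : Type*}
    {N : Type*} [L.Structure N] [MixedStructure K X N] (c : A → N) {m k : ℕ}
    {φ φ' : FFormula L K X A m (k + 1)} (h : Approx φ' φ) (hφ : φ.IsH) :
    ∃ F : Finset X, ∀ η, ∃ p ∈ F, ∀ a (ξ : Fin k → X),
      (φ.Realize c a (Fin.snoc ξ η) → φ'.Realize c a (Fin.snoc ξ p)) ∧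
      (φ.Realize c a (Fin.snoc ξ p) → φ'.Realize c a (Fin.snoc ξ η)) := by
  let : UniformSpace X := uniformSpaceOfCompactR1
  have hev : ∀ᶠ q in 𝓤 X, ∀ ξ : Fin k → X,
      ((Fin.snoc ξ q.1 : Fin (k + 1) → X), (Fin.snoc ξ q.2 : Fin (k + 1) → X)) ∈
        {q : (Fin (k + 1) → X) × (Fin (k + 1) → X) |
          ∀ a, φ.Realize c a q.1 → φ'.Realize c a q.2} := by
    refine eventually_forall_mem_uniformity_pi (𝓤 X)
      (fun i (ξ : Fin k → X) η => (Fin.snoc ξ η : Fin (k + 1) → X) i) (fun i V hV => ?_) _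
      (h.eventually_realize c hφ)
    refine Fin.lastCases ?_ (fun j => ?_) i
    · filter_upwards [hV] with q hq ξ
      simpa using hq
    · exact .of_forall fun q ξ => by simpa using refl_mem_uniformity hV
  obtain ⟨F, hF, hcov⟩ := (isCompact_univ (X := X)).totallyBounded _
    (Filter.inter_mem hev (symm_le_uniformity hev))
  refine ⟨hF.toFinset, fun η => ?_⟩
  obtain ⟨p, hp, h₁, h₂⟩ := Set.mem_iUnion₂.1 (hcov (Set.mem_univ η))
  exact ⟨p, hF.mem_toFinset.2 hp, fun a ξ => ⟨h₁ ξ a, h₂ ξ a⟩⟩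

/-- Finite disjunctions over points of `X`, formed compatibly with approximation. -/
theorem Approx.exists_finset_or [TopologicalSpace X] {A : Type*} {N : Type*} [L.Structure N]
    [MixedStructure K X N] (c : A → N) {m k : ℕ} {φ φ' : FFormula L K X A m (k + 1)}
    (h : Approx φ' φ) (hφ : φ.IsH) (F : Finset X) :
    ∃ θ θ' : FFormula L K X A m k, θ.IsH ∧ Approx θ' θ ∧ ∀ a (ξ : Fin k → X),
      (θ.Realize c a ξ ↔ ∃ p ∈ F, φ.Realize c a (Fin.snoc ξ p)) ∧
      (θ'.Realize c a ξ ↔ ∃ p ∈ F, φ'.Realize c a (Fin.snoc ξ p)) := by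
  classical
  induction F using Finset.induction_on with
  | empty => exact ⟨.home ⊥, _, trivial, .home _, fun a ξ => by simp [FFormula.Realize]⟩
  | insert p F _ ih =>
    obtain ⟨θ, θ', hθ, hθ', e⟩ := ih
    refine ⟨.or (φ.instSpace p) θ, _, ⟨hφ.subst _ _, hθ⟩, .or (h.subst _ _) hθ', fun a ξ => ?_⟩
    simp only [FFormula.Realize, (e a ξ).1, (e a ξ).2, Finset.exists_mem_insert]
    exact ⟨or_congr (FFormula.realize_instSpace c p φ a ξ) Iff.rfl,
      or_congr (FFormula.realize_instSpace c p φ' a ξ) Iff.rfl⟩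

/-- Finite conjunctions over points of `X`, formed compatibly with approximation. -/
theorem Approx.exists_finset_and [TopologicalSpace X] {A : Type*} {N : Type*} [L.Structure N]
    [MixedStructure K X N] (c : A → N) {m k : ℕ} {φ φ' : FFormula L K X A m (k + 1)}
    (h : Approx φ' φ) (hφ : φ.IsH) (F : Finset X) :
    ∃ θ θ' : FFormula L K X A m k, θ.IsH ∧ Approx θ' θ ∧ ∀ a (ξ : Fin k → X),
      (θ.Realize c a ξ ↔ ∀ p ∈ F, φ.Realize c a (Fin.snoc ξ p)) ∧
      (θ'.Realize c a ξ ↔ ∀ p ∈ F, φ'.Realize c a (Fin.snoc ξ p)) := by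
  classical
  induction F using Finset.induction_on with
  | empty => exact ⟨.home ⊤, _, trivial, .home _, fun a ξ => by simp [FFormula.Realize]⟩
  | insert p F _ ih =>
    obtain ⟨θ, θ', hθ, hθ', e⟩ := ih
    refine ⟨.and (φ.instSpace p) θ, _, ⟨hφ.subst _ _, hθ⟩, .and (h.subst _ _) hθ', fun a ξ => ?_⟩
    simp only [FFormula.Realize, (e a ξ).1, (e a ξ).2, Finset.forall_mem_insert]
    exact ⟨and_congr (FFormula.realize_instSpace c p φ a ξ) Iff.rfl,
      and_congr (FFormula.realize_instSpace c p φ' a ξ) Iff.rfl⟩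

/-- Between a formula of the class `F` and an approximation of it there is, in a given structure,
a formula `θ` of the class `H` together with one of its approximations. -/
theorem Approx.exists_isH_between [TopologicalSpace X] [CompactSpace X] [T2Space X] {A : Type*}
    {N : Type*} [L.Structure N] [MixedStructure K X N] (c : A → N) {m k : ℕ}
    {φ φ' : FFormula L K X A m k} (h : Approx φ' φ) :
    ∃ θ θ' : FFormula L K X A m k, θ.IsH ∧ Approx θ' θ ∧ ∀ a ξ,
      (φ.Realize c a ξ → θ.Realize c a ξ) ∧ (θ'.Realize c a ξ → φ'.Realize c a ξ) := by
  induction h with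
  | home φ => exact ⟨.home φ, _, trivial, .home φ, fun a ξ => ⟨id, id⟩⟩
  | mem t C C' h => exact ⟨.mem t C, _, trivial, .mem t C C' h, fun a ξ => ⟨id, id⟩⟩
  | and _ _ ih₁ ih₂ =>
    obtain ⟨θ₁, _, i₁, h₁, e₁⟩ := ih₁
    obtain ⟨θ₂, _, i₂, h₂, e₂⟩ := ih₂
    exact ⟨.and θ₁ θ₂, _, ⟨i₁, i₂⟩, .and h₁ h₂, fun a ξ =>
      ⟨fun h => ⟨(e₁ a ξ).1 h.1, (e₂ a ξ).1 h.2⟩, fun h => ⟨(e₁ a ξ).2 h.1, (e₂ a ξ).2 h.2⟩⟩⟩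
  | or _ _ ih₁ ih₂ =>
    obtain ⟨θ₁, _, i₁, h₁, e₁⟩ := ih₁
    obtain ⟨θ₂, _, i₂, h₂, e₂⟩ := ih₂
    exact ⟨.or θ₁ θ₂, _, ⟨i₁, i₂⟩, .or h₁ h₂, fun a ξ =>
      ⟨fun h => h.imp (e₁ a ξ).1 (e₂ a ξ).1, fun h => h.imp (e₁ a ξ).2 (e₂ a ξ).2⟩⟩
  | allH _ ih =>
    obtain ⟨θ, _, i, h, e⟩ := ih
    exact ⟨.allH θ, _, i, .allH h, fun a ξ =>
      ⟨fun h b => (e _ ξ).1 (h b), fun h b => (e _ ξ).2 (h b)⟩⟩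
  | exH _ ih =>
    obtain ⟨θ, _, i, h, e⟩ := ih
    exact ⟨.exH θ, _, i, .exH h, fun a ξ =>
      ⟨fun ⟨b, h⟩ => ⟨b, (e _ ξ).1 h⟩, fun ⟨b, h⟩ => ⟨b, (e _ ξ).2 h⟩⟩⟩
  | allS _ ih =>
    obtain ⟨θ, θ', i, h, e⟩ := ih
    -- The conjunction of the `θ(p)` is approximated by that of the `χ(p)`, which implies all `θ'(η)`.
    obtain ⟨χ, h₁, h₂⟩ := h.exists_between
    obtain ⟨F, hF⟩ := h₂.exists_finset_points c (h₁.isH i)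
    obtain ⟨ρ, ρ', hρ, hρ', eρ⟩ := h₁.exists_finset_and c i F
    refine ⟨ρ, ρ', hρ, hρ', fun a ξ => ⟨fun h => ?_, fun h η => ?_⟩⟩
    · exact (eρ a ξ).1.2 fun p _ => (e a _).1 (h p)
    · obtain ⟨p, hp, hpη⟩ := hF η
      exact (e a _).2 ((hpη a ξ).2 ((eρ a ξ).2.1 h p hp))
  | exS _ ih =>
    obtain ⟨θ, θ', i, h, e⟩ := ih
    -- Every instance `θ(η)` implies some `χ(p)`, and the latter is approximated by `θ'(p)`.
    obtain ⟨χ, h₁, h₂⟩ := h.exists_between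
    obtain ⟨F, hF⟩ := h₁.exists_finset_points c i
    obtain ⟨ρ, ρ', hρ, hρ', eρ⟩ := h₂.exists_finset_or c (h₁.isH i) F
    refine ⟨ρ, ρ', hρ, hρ', fun a ξ => ⟨fun ⟨η, h⟩ => ?_, fun h => ?_⟩⟩
    · obtain ⟨p, hp, hpη⟩ := hF η
      exact (eρ a ξ).1.2 ⟨p, hp, (hpη a ξ).1 ((e a _).1 h)⟩
    · obtain ⟨p, _, h⟩ := (eρ a ξ).2.1 h
      exact ⟨p, (e a _).2 h⟩

/-! ### The Tarski–Vaught test -/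

section TarskiVaught

variable [TopologicalSpace X] {U : Type y} [L.Structure U] [MixedStructure K X U] {M : Set U}

/-- The Tarski–Vaught test for the class `F`: if the negation of `φ(g, x ; ξ)`, where `φ ∈ F` has no
names, `g` is a tuple from `M` and `ξ` a tuple of points, has a solution in `U`, then it has one in
`M`. -/
def TarskiVaughtTest (L : FirstOrder.Language.{u, v}) (K : ℕ → Type w) (X : Type x)
    [TopologicalSpace X] {U : Type y} [L.Structure U] [MixedStructure K X U] (M : Set U) : Prop :=
  ∀ (n k : ℕ) (φ : FFormula L K X Empty (n + 1) k) (g : Fin n → M) (ξ : Fin k → X) (b : U),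
    ¬ φ.Realize Empty.elim (Fin.snoc (Subtype.val ∘ g) b) ξ →
      ∃ b' ∈ M, ¬ φ.Realize Empty.elim (Fin.snoc (Subtype.val ∘ g) b') ξ

theorem HWitness.tarskiVaughtTest [CompactSpace X] [T2Space X] [Infinite U]
    (hU : IsFSaturated L K X U) (h : HWitness L K X M 1) : TarskiVaughtTest L K X M := by
  intro n k φ g ξ b hb
  obtain ⟨φ', hφ', hb'⟩ := not_forall₂.1 (mt (hU.realize_of_forall_approx φ _ ξ) hb)
  obtain ⟨ψ, ψ', hψ, e⟩ := hφ'.exists_strong_negation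
  obtain ⟨θ, θ', i, hθ, e'⟩ := hψ.exists_isH_between (N := U) Empty.elim
  obtain ⟨a, ha, h⟩ := h (FFormula.inst (j := 1) g ξ θ) (i.subst _ _)
    ⟨fun _ => b, by
      rw [FFormula.realize_inst, Fin.append_right_eq_snoc]
      exact (e' _ _).1 ((e U _ _ _).1 hb')⟩ _ (hθ.subst _ _)
  refine ⟨a 0, ha 0, (e U _ _ _).2 ((e' _ _).2 ?_)⟩
  rwa [← Fin.append_right_eq_snoc, ← FFormula.realize_inst]

theorem TarskiVaughtTest.exists_append (h : TarskiVaughtTest L K X M) {n k : ℕ} (g : Fin n → M)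
    (ξ : Fin k → X) {m : ℕ} : ∀ (φ : FFormula L K X Empty (n + m) k) (b : Fin m → U),
    ¬ φ.Realize Empty.elim (Fin.append (Subtype.val ∘ g) b) ξ →
      ∃ a : Fin m → M, ¬ φ.Realize Empty.elim (Fin.append (Subtype.val ∘ g) (Subtype.val ∘ a)) ξ := by
  induction m with
  | zero => exact fun φ b hb => ⟨Fin.elim0, by rwa [Subsingleton.elim (_ ∘ Fin.elim0) b]⟩
  | succ m ih =>
    intro φ b hb
    rw [← Fin.snoc_init_self b, Fin.append_snoc] at hb
    obtain ⟨a, ha⟩ := ih (.allH φ) (Fin.init b) fun h => hb (h _)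
    obtain ⟨y, hy⟩ := not_forall.1 ha
    have e : Fin.append (Subtype.val ∘ g) (Subtype.val ∘ a) = Subtype.val ∘ Fin.append g a := by
      funext i
      refine Fin.addCases (fun i => ?_) (fun i => ?_) i <;> simp
    rw [e] at hy
    obtain ⟨y', hyM, hy'⟩ := h _ _ φ (Fin.append g a) ξ y hy
    refine ⟨Fin.snoc a ⟨y', hyM⟩, ?_⟩
    rwa [Fin.comp_snoc, Fin.append_snoc, e]

theorem TarskiVaughtTest.fWitness (h : TarskiVaughtTest L K X M) (m : ℕ) : FWitness L K X M m := by
  rintro φ ⟨b, hb⟩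
  obtain ⟨n, g, φ₀, e⟩ := φ.exists_eq_inst
  obtain ⟨a, ha⟩ := h.exists_append g Fin.elim0 φ₀ b (mt (e U _ _ _).2 hb)
  exact ⟨_, fun i => (a i).2, mt (e U _ _ _).1 ha⟩

theorem FWitness.hWitness [CompactSpace X] [T2Space X] {m : ℕ} (h : FWitness L K X M m) :
    HWitness L K X M m := by
  rintro φ - ⟨b, hb⟩ φ' hφ'
  obtain ⟨ψ, ψ', hψ, e⟩ := hφ'.exists_strong_negation
  obtain ⟨a, ha, h⟩ := h ψ ⟨b, fun h => (e U _ _ _).2 (hψ.realize _ h) hb⟩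
  exact ⟨a, ha, not_not.1 fun h' => h ((e U _ _ _).1 h')⟩

theorem TarskiVaughtTest.isModel (h : TarskiVaughtTest L K X M) : IsModel L K X M := by
  have hfun {n : ℕ} (f : L.Functions n) : FirstOrder.Language.ClosedUnder f M := by
    intro a ha
    obtain ⟨b, hb, hbf⟩ := h n 0
      (.home (((FirstOrder.Language.Term.func f fun i => .var (.inr i.castSucc)).bdEqual
        (.var (.inr (Fin.last n)))).not)) (fun i => ⟨a i, ha i⟩) Fin.elim0
      (FirstOrder.Language.Structure.funMap f a) (by
        simp [FFormula.Realize, Function.comp_def])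
    simp only [FFormula.Realize, FirstOrder.Language.BoundedFormula.realize_not, not_not,
      FirstOrder.Language.BoundedFormula.realize_bdEqual,
      FirstOrder.Language.Term.realize_func, FirstOrder.Language.Term.realize_var, Sum.elim_inr,
      Fin.snoc_castSucc, Fin.snoc_last, Function.comp_apply] at hbf
    rwa [hbf]
  let S : L.Substructure U := ⟨M, hfun⟩
  have hS : S.IsElementary := by
    refine S.isElementary_of_exists fun n φ a b hb => ?_
    rw [Subsingleton.elim default Empty.elim] at hb
    obtain ⟨b', hb', hφ⟩ := h n 0 (.home φ.not) a Fin.elim0 b (by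
      rw [FFormula.Realize, FirstOrder.Language.BoundedFormula.realize_not, not_not]
      exact hb)
    rw [FFormula.Realize, FirstOrder.Language.BoundedFormula.realize_not, not_not] at hφ
    rw [Subsingleton.elim Empty.elim default] at hφ
    exact ⟨⟨b', hb'⟩, hφ⟩
  have hterm {m k : ℕ} (t : STerm L K X (Empty ⊕ Fin m) (Fin k)) (a : Fin m → S) (ξ : Fin k → X) :
      t.realize (Sum.elim Empty.elim (Subtype.val ∘ a) : _ → U) ξ =
        t.realize (Sum.elim Empty.elim a) ξ := by
    have e : (Sum.elim Empty.elim (Subtype.val ∘ a) : Empty ⊕ Fin m → U) =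
        S.subtype ∘ Sum.elim Empty.elim a := by
      funext i
      rcases i with i | i
      · exact i.elim
      · rfl
    rw [e]
    induction t with
    | var i => rfl
    | space f ts ih => simp only [STerm.realize, ih]
    | mixed f ts =>
      simp only [STerm.realize, FirstOrder.Language.HomClass.realize_term]
      rfl
  have hmain {m k : ℕ} (φ : FFormula L K X Empty m k) : ∀ (a : Fin m → S) (ξ : Fin k → X),
      φ.Realize Empty.elim a ξ → φ.Realize Empty.elim (Subtype.val ∘ a) ξ := by
    induction φ with
    | home φ =>
      intro a ξ h
      have := ((⟨S, hS⟩ : L.ElementarySubstructure U).subtype.map_boundedFormula φ Empty.elim a).2 h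
      rwa [Subsingleton.elim (_ ∘ Empty.elim) Empty.elim] at this
    | mem t C =>
      intro a ξ h
      simp only [FFormula.Realize, hterm]
      exact h
    | and φ ψ ih₁ ih₂ => exact fun a ξ h => ⟨ih₁ a ξ h.1, ih₂ a ξ h.2⟩
    | or φ ψ ih₁ ih₂ => exact fun a ξ h => h.imp (ih₁ a ξ) (ih₂ a ξ)
    | allH φ ih =>
      intro a ξ hφ b
      by_contra hb
      obtain ⟨b', hb', hn⟩ := h _ _ φ a ξ b hb
      refine hn ?_
      have := ih _ ξ (hφ ⟨b', hb'⟩)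
      rwa [Fin.comp_snoc] at this
    | exH φ ih =>
      rintro a ξ ⟨b, hb⟩
      refine ⟨b, ?_⟩
      have := ih _ ξ hb
      rwa [Fin.comp_snoc] at this
    | allS φ ih => exact fun a ξ h b => ih a _ (h b)
    | exS φ ih => exact fun a ξ ⟨b, h⟩ => ⟨b, ih a _ h⟩
  exact ⟨S, rfl, fun m φ a h => by
    have := hmain φ a Fin.elim0 h
    exact this⟩

theorem IsModel.tarskiVaughtTest [CompactSpace X] [T2Space X] [Infinite U]
    (hU : IsFSaturated L K X U) (h : IsModel L K X M) : TarskiVaughtTest L K X M := by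
  obtain ⟨S, rfl, hS⟩ := h
  have hS' {m k : ℕ} (φ : FFormula L K X Empty m k) (a : Fin m → S) (ξ : Fin k → X)
      (h : φ.Realize Empty.elim a ξ) : φ.Realize Empty.elim (Subtype.val ∘ a) ξ := by
    have key {N : Type y} [L.Structure N] [MixedStructure K X N] (a : Fin m → N) :
        (φ.subst id (Sum.inl ∘ ξ : Fin k → X ⊕ Fin 0)).Realize Empty.elim a Fin.elim0 ↔
          φ.Realize Empty.elim a ξ := FFormula.realize_subst _ _ _ _ _ _
    exact (key _).1 (hS m _ a ((key a).2 h))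
  intro n k φ g ξ b hb
  obtain ⟨φ', hφ', hb'⟩ := not_forall₂.1 (mt (hU.realize_of_forall_approx φ _ ξ) hb)
  obtain ⟨ψ, ψ', hψ, e⟩ := hφ'.exists_strong_negation
  by_contra! hM
  -- If `φ(g, x ; ξ)` holds in `U` on all of `M`, then `∀ x φ'(g, x ; ξ)` holds in `M`, hence in `U`.
  refine hb' (hS' (.allH φ') g ξ (fun b' => ?_) b)
  by_contra hb''
  have := (e U _ _ _).2 (hψ.realize _ (hS' ψ _ ξ ((e S _ _ _).1 hb'')))
  rw [Fin.comp_snoc] at this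
  exact this (hM b' b'.2)

end TarskiVaught

end TwoSorted

theorem mainTheorem8 (L : FirstOrder.Language.{u, v}) (K : ℕ → Type w)
    (X : Type x) [TopologicalSpace X] [CompactSpace X] [T2Space X] [Nonempty X]
    (U : Type y) [L.Structure U] [TwoSorted.MixedStructure K X U] [Infinite U]
    (hU : TwoSorted.IsFSaturated L K X U) (M : Set U) :
    List.TFAE [
      TwoSorted.IsModel L K X M,
      ∀ m : ℕ, TwoSorted.HWitness L K X M m,
      ∀ m : ℕ, TwoSorted.FWitness L K X M m,
      TwoSorted.HWitness L K X M 1,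
      TwoSorted.FWitness L K X M 1] := by
  tfae_have 1 → 3 := fun h => (h.tarskiVaughtTest hU).fWitness
  tfae_have 3 → 2 := fun h m => (h m).hWitness
  tfae_have 2 → 4 := fun h => h 1
  tfae_have 3 → 5 := fun h => h 1
  tfae_have 5 → 4 := fun h => h.hWitness
  tfae_have 4 → 1 := fun h => (h.tarskiVaughtTest hU).isModel
  tfae_finish
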